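/- Let $\mathcal{S}^1$ and $\mathcal{S}^2$ be the trace class and the Hilbert–Schmidt operators on $L^2(\mathbb{R}^d)$. For $z=(x,\xi)\in\mathbb{R}^{2d}$ let $\rho(z)f(t)=e^{-\pi i x\cdot\xi}e^{2\pi i\xi\cdot t}f(t-x)$, and let $\mathcal{F}_W(T)(z)=\mathrm{tr}(T\rho(z)^*)$ be the Fourier–Wigner transform of $T\in\mathcal{S}^1$. For $m\in L^\infty(\mathbb{R}^{2d})$ and $T\in\mathcal{S}^1$ put $$\mathfrak{T}_m(T)=\int_{\mathbb{R}^{2d}}m(z)\,\mathcal{F}_W(T)(z)\,\rho(z)\,dz\quad\text{(weak integral)}.$$ Let $\mathfrak{M}_2$ be the set of all $m\in L^\infty(\mathbb{R}^{2d})$ for which $\mathfrak{T}_m$ extends to a bounded linear operator $\mathcal{S}^2\to\mathcal{S}^2$, and let $\|m\|_{\mathfrak{M}_2}$ be the operator norm of this extension. With $\sigma((x,\xi),(x',\xi'))=x'\cdot\xi-x\cdot\xi'$ and $\mathcal{F}_\sigma(\Psi)(\zeta)=\int_{\mathbb{R}^{2d}}\Psi(z)e^{-2\pi i\sigma(\zeta,z)}\,dz$,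 put, for a Schwartz function $\Psi$ on $\mathbb{R}^{2d}$, $$T_m(\Psi)(z)=\int_{\mathbb{R}^{2d}}m(\zeta)\,\mathcal{F}_\sigma(\Psi)(\zeta)\,e^{-2\pi i\sigma(z,\zeta)}\,d\zeta .$$ Let $\mathcal{M}_2$ be the set of all $m\in L^\infty(\mathbb{R}^{2d})$ for which $T_m$ extends to a bounded linear operator on $L^2(\mathbb{R}^{2d})$, and let $\|m\|_{\mathcal{M}_2}$ be the operator norm of this extension. **Proposition.** $\mathfrak{M}_2=\mathcal{M}_2=L^\infty(\mathbb{R}^{2d})$. For every $m\in L^\infty(\mathbb{R}^{2d})$ the bounded extensions of $\mathfrak{T}_m$ to $\mathcal{S}^2$ and of $T_m$ to $L^2(\mathbb{R}^{2d})$ are unique, and $$\|m\|_{\mathfrak{M}_2}=\|m\|_{\mathcal{M}_2}=\|m\|_{L^\infty(\mathbb{R}^{2d})}.$$ In particular, the identity map is an isometric isomorphism from $\mathfrak{M}_2$ onto $L^\infty(\mathbb{R}^{2d})$. -/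

import Mathlib

open MeasureTheory
open scoped ENNReal InnerProductSpace SchwartzMap

noncomputable section

namespace FourierWigner

/-- The configuration space `ℝ^d`. -/
abbrev Config (d : ℕ) : Type := EuclideanSpace ℝ (Fin d)

/-- The phase space `ℝ^{2d}`, with points `z = (x, ξ)` and Lebesgue measure. -/
abbrev Phase (d : ℕ) : Type := Config d × Config d

/-- The Hilbert space `L²(ℝ^d)`. -/
abbrev L2 (d : ℕ) : Type := Lp ℂ 2 (volume : Measure (Config d))

/-- The space `L²(ℝ^{2d})`. -/
abbrev L2Phase (d : ℕ) : Type := Lp ℂ 2 (volume : Measure (Phase d))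

/-- The space `L^∞(ℝ^{2d})`. -/
abbrev LInfPhase (d : ℕ) : Type := Lp ℂ ∞ (volume : Measure (Phase d))

/-- The bounded operators on `L²(ℝ^d)`. -/
abbrev Op (d : ℕ) : Type := L2 d →L[ℂ] L2 d

/-- The standard symplectic form `σ((x, ξ), (x', ξ')) = x' ⬝ ξ - x ⬝ ξ'`. -/
def sympl {d : ℕ} (z w : Phase d) : ℝ := ⟪w.1, z.2⟫_ℝ - ⟪z.1, w.2⟫_ℝ

/-! ### Symplectic Fourier multipliers on functions -/

/-- The symplectic Fourier transform `ℱ_σ Ψ (ζ) = ∫ Ψ(z) e^{-2πi σ(ζ, z)} dz`. -/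
def symplFourier {d : ℕ} (Ψ : Phase d → ℂ) (ζ : Phase d) : ℂ :=
  ∫ z, Ψ z * Complex.exp (-2 * Real.pi * Complex.I * (sympl ζ z : ℂ))

/-- `T_m Ψ (z) = ∫ m(ζ) ℱ_σ Ψ (ζ) e^{-2πi σ(z, ζ)} dζ` for a Schwartz function `Ψ`. -/
def fourierMul {d : ℕ} (m : LInfPhase d) (Ψ : 𝓢(Phase d, ℂ)) (z : Phase d) : ℂ :=
  ∫ ζ, m ζ * symplFourier Ψ ζ * Complex.exp (-2 * Real.pi * Complex.I * (sympl z ζ : ℂ))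

instance (d : ℕ) : Measure.IsAddHaarMeasure (volume : Measure (Phase d)) :=
  inferInstanceAs (Measure.IsAddHaarMeasure
    ((volume : Measure (Config d)).prod (volume : Measure (Config d))))

/-- The bounded operator `B` on `L²(ℝ^{2d})` extends `T_m` from the Schwartz class. -/
def ExtendsFourierMul {d : ℕ} (m : LInfPhase d) (B : L2Phase d →L[ℂ] L2Phase d) : Prop :=
  ∀ Ψ : 𝓢(Phase d, ℂ), B (Ψ.toLp 2 volume) =ᵐ[volume] fourierMul m Ψ

/-- `ℳ_2`: the `m ∈ L^∞` for which `T_m` extends to a bounded operator on `L²(ℝ^{2d})`. -/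
def fourierMultipliers (d : ℕ) : Set (LInfPhase d) :=
  {m | ∃ B : L2Phase d →L[ℂ] L2Phase d, ExtendsFourierMul m B}

/-- `‖m‖_{ℳ_2}`: the operator norm of the bounded extension of `T_m` to `L²(ℝ^{2d})`. -/
def fourierMultiplierNorm {d : ℕ} (m : LInfPhase d) : ℝ :=
  sInf {r | ∃ B : L2Phase d →L[ℂ] L2Phase d, ExtendsFourierMul m B ∧ r = ‖B‖}

/-! ### The symmetric time-frequency shifts -/

/-- The pointwise formula `e^{-πi x⬝ξ} e^{2πi ξ⬝t} f(t - x)`. -/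
def shiftFun {d : ℕ} (z : Phase d) (f : Config d → ℂ) (t : Config d) : ℂ :=
  Complex.exp (-Real.pi * Complex.I * (⟪z.1, z.2⟫_ℝ : ℂ)) *
    Complex.exp (2 * Real.pi * Complex.I * (⟪z.2, t⟫_ℝ : ℂ)) * f (t - z.1)

theorem norm_shiftFun {d : ℕ} (z : Phase d) (f : Config d → ℂ) (t : Config d) :
    ‖shiftFun z f t‖ = ‖f (t - z.1)‖ := by
  have h1 : ‖Complex.exp (-Real.pi * Complex.I * (⟪z.1, z.2⟫_ℝ : ℂ))‖ = 1 := by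
    rw [Complex.norm_exp]; simp
  have h2 : ‖Complex.exp (2 * Real.pi * Complex.I * (⟪z.2, t⟫_ℝ : ℂ))‖ = 1 := by
    rw [Complex.norm_exp]; simp
  rw [shiftFun, norm_mul, norm_mul, h1, h2, one_mul, one_mul]

theorem memLp_shiftFun {d : ℕ} (z : Phase d) (f : L2 d) :
    MemLp (shiftFun z f) 2 (volume : Measure (Config d)) := by
  have h : MemLp (fun t => f (t - z.1)) 2 (volume : Measure (Config d)) :=
    (Lp.memLp f).comp_measurePreserving (measurePreserving_sub_right volume z.1)
  refine h.of_le ?_ (Filter.Eventually.of_forall fun t => (norm_shiftFun z f t).le)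
  refine AEStronglyMeasurable.mul ?_ h.1
  exact Continuous.aestronglyMeasurable (by fun_prop)

theorem shiftFun_congr {d : ℕ} (z : Phase d) {f g : Config d → ℂ} (h : f =ᵐ[volume] g) :
    shiftFun z f =ᵐ[volume] shiftFun z g := by
  have := (measurePreserving_sub_right (volume : Measure (Config d))
    z.1).quasiMeasurePreserving.ae_eq_comp h
  filter_upwards [this] with t ht
  simp only [Function.comp_apply] at ht
  simp [shiftFun, ht]

/-- The symmetric time-frequency shift `ρ(z)`, an isometry of `L²(ℝ^d)`. -/
def rhoIsometry {d : ℕ} (z : Phase d) : L2 d →ₗᵢ[ℂ] L2 d where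
  toFun f := (memLp_shiftFun z f).toLp _
  map_add' f g := by
    rw [← MemLp.toLp_add]
    refine MemLp.toLp_congr _ _ ((shiftFun_congr z (Lp.coeFn_add f g)).trans ?_)
    exact Filter.Eventually.of_forall fun t => by simp [shiftFun, mul_add]
  map_smul' c f := by
    rw [RingHom.id_apply, ← MemLp.toLp_const_smul]
    refine MemLp.toLp_congr _ _ ((shiftFun_congr z (Lp.coeFn_smul c f)).trans ?_)
    exact Filter.Eventually.of_forall fun t => by simp [shiftFun]; ring
  norm_map' f := by
    change ‖(memLp_shiftFun z f).toLp _‖ = ‖f‖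
    rw [Lp.norm_toLp, Lp.norm_def]
    congr 1
    rw [← eLpNorm_comp_measurePreserving (Lp.aestronglyMeasurable f)
      (measurePreserving_sub_right volume z.1)]
    exact eLpNorm_congr_norm_ae (Filter.Eventually.of_forall fun t => norm_shiftFun z f t)

/-- The symmetric time-frequency shift `ρ(z)` as a bounded operator on `L²(ℝ^d)`. -/
def rho {d : ℕ} (z : Phase d) : Op d := (rhoIsometry z).toContinuousLinearMap

theorem rho_ae_eq {d : ℕ} (x ξ : Config d) (f : L2 d) :
    rho (x, ξ) f =ᵐ[volume] fun t =>
      Complex.exp (-Real.pi * Complex.I * (⟪x, ξ⟫_ℝ : ℂ)) *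
        Complex.exp (2 * Real.pi * Complex.I * (⟪ξ, t⟫_ℝ : ℂ)) * f (t - x) :=
  (memLp_shiftFun (x, ξ) f).coeFn_toLp

/-! ### Hilbert-Schmidt and trace class operators -/

/-- The index set of an orthonormal basis of `L²(ℝ^d)`. -/
def onbIndex (d : ℕ) : Set (L2 d) := (exists_hilbertBasis ℂ (L2 d)).choose

/-- An orthonormal basis of `L²(ℝ^d)`. -/
def onb (d : ℕ) : HilbertBasis (onbIndex d) ℂ (L2 d) :=
  (exists_hilbertBasis ℂ (L2 d)).choose_spec.choose

theorem tsum_enorm_sq_inner {d : ℕ} {ι : Type*} (b : HilbertBasis ι ℂ (L2 d)) (f : L2 d) :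
    ∑' i, ‖⟪b i, f⟫_ℂ‖ₑ ^ 2 = ‖f‖ₑ ^ 2 := by
  have h := b.hasSum_inner_mul_inner f f
  have h2 : HasSum (fun i => ‖⟪b i, f⟫_ℂ‖ ^ 2) (‖f‖ ^ 2) := by
    have h3 := Complex.hasSum_re h
    have e1 : (⟪f, f⟫_ℂ).re = ‖f‖ ^ 2 := inner_self_eq_norm_sq (𝕜 := ℂ) f
    rw [e1] at h3
    refine h3.congr_fun ?_
    intro i
    rw [← inner_conj_symm f (b i), mul_comm, Complex.mul_conj, Complex.normSq_eq_norm_sq]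
    exact (Complex.ofReal_re _).symm
  have e (x : ℝ) (hx : 0 ≤ x) : ENNReal.ofReal (x ^ 2) = ENNReal.ofReal x ^ 2 :=
    ENNReal.ofReal_pow hx 2
  rw [← ofReal_norm, ← e _ (norm_nonneg _), ← h2.tsum_eq,
    ENNReal.ofReal_tsum_of_nonneg (fun i => by positivity) h2.summable]
  exact tsum_congr fun i => by rw [← ofReal_norm, e _ (norm_nonneg _)]

theorem tsum_enorm_sq_eq_adjoint {d : ℕ} {ι κ : Type*} (b : HilbertBasis ι ℂ (L2 d))
    (c : HilbertBasis κ ℂ (L2 d)) (T : Op d) :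
    ∑' i, ‖T (b i)‖ₑ ^ 2 = ∑' k, ‖T.adjoint (c k)‖ₑ ^ 2 := by
  simp_rw [← tsum_enorm_sq_inner c (T _)]
  rw [ENNReal.tsum_comm]
  refine tsum_congr fun k => ?_
  rw [← tsum_enorm_sq_inner b]
  refine tsum_congr fun i => ?_
  rw [ContinuousLinearMap.adjoint_inner_right, ← ofReal_norm, norm_inner_symm,
    ofReal_norm]

/-- `∑ ‖T eᵢ‖²` does not depend on the orthonormal basis `(eᵢ)`. -/
theorem tsum_enorm_sq_eq {d : ℕ} {ι κ : Type*} (b : HilbertBasis ι ℂ (L2 d))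
    (c : HilbertBasis κ ℂ (L2 d)) (T : Op d) :
    ∑' i, ‖T (b i)‖ₑ ^ 2 = ∑' j, ‖T (c j)‖ₑ ^ 2 :=
  (tsum_enorm_sq_eq_adjoint b c T).trans (tsum_enorm_sq_eq_adjoint c c T).symm

/-- The operators `T` with `∑ ‖T eᵢ‖² < ∞`. -/
def hilbertSchmidtSubmodule (d : ℕ) : Submodule ℂ (Op d) where
  carrier := {T | Memℓp (fun i => T (onb d i)) 2}
  add_mem' hS hT := hS.add hT
  zero_mem' := zero_memℓp
  smul_mem' c _ hT := hT.const_smul c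

/-- The Hilbert-Schmidt class `𝒮²`, as a space with its own norm
`‖T‖ = (∑ ‖T eᵢ‖²)^{1/2}` (and not the operator norm). -/
def S2 (d : ℕ) : Type := hilbertSchmidtSubmodule d

instance (d : ℕ) : AddCommGroup (S2 d) := inferInstanceAs (AddCommGroup (hilbertSchmidtSubmodule d))

instance (d : ℕ) : Module ℂ (S2 d) := inferInstanceAs (Module ℂ (hilbertSchmidtSubmodule d))

/-- The bounded operator underlying a Hilbert-Schmidt operator. -/
def S2.toOp {d : ℕ} (T : S2 d) : Op d := Subtype.val T

/-- The linear map `T ↦ (T eᵢ)ᵢ` from `𝒮²` to `ℓ²(L²(ℝ^d))`. -/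
def S2.coords (d : ℕ) : S2 d →ₗ[ℂ] lp (fun _ : onbIndex d => L2 d) 2 where
  toFun T := ⟨fun i => T.toOp (onb d i), Subtype.property T⟩
  map_add' _ _ := rfl
  map_smul' _ _ := rfl

theorem S2.coords_injective (d : ℕ) : Function.Injective (S2.coords d) := by
  intro S T h
  refine Subtype.ext ?_
  refine ContinuousLinearMap.ext_on
    (Submodule.dense_iff_topologicalClosure_eq_top.mpr (onb d).dense_span) ?_
  rintro _ ⟨i, rfl⟩
  exact congrFun (congrArg Subtype.val h) i

instance (d : ℕ) : NormedAddCommGroup (S2 d) :=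
  NormedAddCommGroup.induced (S2 d) _ (S2.coords d) (S2.coords_injective d)

instance (d : ℕ) : NormedSpace ℂ (S2 d) := NormedSpace.induced ℂ (S2 d) _ (S2.coords d)

theorem S2.norm_sq_eq {d : ℕ} (T : S2 d) : ‖T‖ ^ 2 = ∑' i, ‖T.toOp (onb d i)‖ ^ 2 := by
  have h := lp.norm_rpow_eq_tsum (p := 2) (by norm_num) (S2.coords d T)
  simp only [ENNReal.toReal_ofNat, Real.rpow_ofNat] at h
  exact h

/-- The trace class `𝒮¹`: operators with a singular value decomposition
`T = ∑ sₙ ⟨·, ηₙ⟩ eₙ` whose singular values are summable. -/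
def IsTraceClass {d : ℕ} (T : Op d) : Prop :=
  ∃ (ι : Type) (s : ι → ℝ) (e η : ι → L2 d), (∀ n, 0 ≤ s n) ∧ Summable s ∧
    Orthonormal ℂ e ∧ Orthonormal ℂ η ∧
    HasSum (fun n => (s n : ℂ) • InnerProductSpace.rankOne ℂ (e n) (η n)) T

/-- The trace `∑ ⟨T eᵢ, eᵢ⟩`, for trace class `T`. -/
def trace {d : ℕ} (T : Op d) : ℂ := ∑' i, ⟪onb d i, T (onb d i)⟫_ℂ

/-! ### Fourier-Wigner multipliers -/

/-- The Fourier-Wigner transform `ℱ_W T (z) = tr(T ρ(z)^*)`, for trace class `T`. -/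
def fourierWigner {d : ℕ} (T : Op d) (z : Phase d) : ℂ := trace (T ∘L (rho z).adjoint)

/-- `S = ∫ F(z) ρ(z) dz`, where the integral is considered weakly. -/
def IsWeakIntegral {d : ℕ} (F : Phase d → ℂ) (S : Op d) : Prop :=
  ∀ f g : L2 d, Integrable (fun z => F z * ⟪g, rho z f⟫_ℂ) volume ∧
    ⟪g, S f⟫_ℂ = ∫ z, F z * ⟪g, rho z f⟫_ℂ

/-- `S = 𝔗_m T = ∫ m(z) ℱ_W T (z) ρ(z) dz` weakly, for trace class `T`. -/
def IsFWMul {d : ℕ} (m : LInfPhase d) (T S : Op d) : Prop :=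
  IsWeakIntegral (fun z => m z * fourierWigner T z) S

/-- The bounded operator `A` on `𝒮²` extends `𝔗_m` from `𝒮¹`. -/
def ExtendsFWMul {d : ℕ} (m : LInfPhase d) (A : S2 d →L[ℂ] S2 d) : Prop :=
  ∀ T : S2 d, IsTraceClass T.toOp → IsFWMul m T.toOp (A T).toOp

/-- `𝔐_2`: the `m ∈ L^∞` for which `𝔗_m` extends to a bounded operator on `𝒮²`. -/
def fwMultipliers (d : ℕ) : Set (LInfPhase d) :=
  {m | ∃ A : S2 d →L[ℂ] S2 d, ExtendsFWMul m A}

/-- `‖m‖_{𝔐_2}`: the operator norm of the bounded extension of `𝔗_m` to `𝒮²`. -/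
def fwMultiplierNorm {d : ℕ} (m : LInfPhase d) : ℝ :=
  sInf {r | ∃ A : S2 d →L[ℂ] S2 d, ExtendsFWMul m A ∧ r = ‖A‖}

end FourierWigner

end

/-! Up to unitaries, both operators are multiplication by `m` on `L²(ℝ^{2d})`, whose norm is the
essential supremum of `|m|` (`norm_mulOp`). For functions the unitary is `ℱ_σ`: `T_m Ψ` is `ℱ_σ (m
ℱ_σ Ψ)`. For operators it is the Fourier-Wigner transform `𝒮² → L²(ℝ^{2d})`, which sends the
rank-one operator `⟨v, ·⟩ u` to the ambiguity function `A(u, v)(z) = ⟨ρ(z) v, u⟩`. It is isometric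
by Moyal's identity (`inner_amb_amb`) and onto because ambiguity functions are total
(`eq_zero_of_inner_amb_eq_zero`). The relation `⟨A(g, f), ℱ_W S⟩ = ⟨g, S f⟩`
(`inner_amb_fourierWignerL2`) is the weak inversion formula, and `fourierWignerL2_ae_eq` identifies
the unitary with `tr(T ρ(z)^*)` on the trace class. Hence `𝔗_m` is `ℱ_W⁻¹ (m ℱ_W T)`. The extensions
are unique because Schwartz functions are dense in `L²`, and sums of rank-one operators are dense in
`𝒮²`. -/

noncomputable section

namespace FourierWigner

/-! ### Multiplication operators on `L²`. -/

section MulOp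

variable {α : Type*} [MeasurableSpace α] {μ : Measure α}

/-- Multiplication by an essentially bounded function, as an operator on `L²`. -/
def mulOp (m : Lp ℂ ∞ μ) : Lp ℂ 2 μ →L[ℂ] Lp ℂ 2 μ :=
  (ContinuousLinearMap.mul ℂ ℂ).holderL μ ∞ 2 2 m

theorem coeFn_mulOp (m : Lp ℂ ∞ μ) (f : Lp ℂ 2 μ) :
    mulOp m f =ᵐ[μ] fun x => m x * f x :=
  (ContinuousLinearMap.mul ℂ ℂ).coeFn_holder m f

theorem norm_mulOp_le (m : Lp ℂ ∞ μ) : ‖mulOp m‖ ≤ ‖m‖ := by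
  refine ContinuousLinearMap.opNorm_le_bound _ (norm_nonneg _) fun f => ?_
  refine ((ContinuousLinearMap.mul ℂ ℂ).norm_holder_apply_apply_le m f).trans ?_
  gcongr
  exact mul_le_of_le_one_left (norm_nonneg _) (ContinuousLinearMap.opNorm_mul_le ℂ ℂ)

theorem enorm_sq_eq_lintegral (f : Lp ℂ 2 μ) : ‖f‖ₑ ^ 2 = ∫⁻ x, ‖f x‖ₑ ^ 2 ∂μ := by
  rw [Lp.enorm_def, eLpNorm_eq_lintegral_rpow_enorm_toReal (by norm_num) (by norm_num)]
  simp only [ENNReal.toReal_ofNat, ENNReal.rpow_ofNat, one_div]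
  rw [← ENNReal.rpow_natCast, ← ENNReal.rpow_mul]
  norm_num

/-- Testing on indicators of sets `s` of finite measure gives `∫_s |m|² ≤ ‖mulOp m‖² μ(s)`, so `|m|
≤ ‖mulOp m‖` almost everywhere. -/
theorem norm_mulOp [SigmaFinite μ] (m : Lp ℂ ∞ μ) : ‖mulOp m‖ = ‖m‖ := by
  refine le_antisymm (norm_mulOp_le m) ?_
  have key : ∀ᵐ x ∂μ, ‖m x‖ₑ ^ 2 ≤ ‖mulOp m‖ₑ ^ 2 := by
    refine ae_le_of_forall_setLIntegral_le_of_sigmaFinite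
      ((Lp.stronglyMeasurable m).measurable.enorm.pow_const 2) fun s hs hfin => ?_
    have hs' : μ s ≠ ∞ := hfin.ne
    have h1 : ‖indicatorConstLp 2 hs hs' (1 : ℂ)‖ₑ ^ 2 = μ s := by
      rw [enorm_sq_eq_lintegral]
      rw [← lintegral_indicator_one hs]
      refine lintegral_congr_ae ?_
      filter_upwards [indicatorConstLp_coeFn (p := 2) (hs := hs) (hμs := hs') (c := (1 : ℂ))]
        with x hx
      rw [hx]
      by_cases h : x ∈ s <;> simp [h]
    have h2 : ‖mulOp m (indicatorConstLp 2 hs hs' (1 : ℂ))‖ₑ ^ 2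
        = ∫⁻ x in s, ‖m x‖ₑ ^ 2 ∂μ := by
      rw [enorm_sq_eq_lintegral, ← lintegral_indicator hs]
      refine lintegral_congr_ae ?_
      filter_upwards [indicatorConstLp_coeFn (p := 2) (hs := hs) (hμs := hs') (c := (1 : ℂ)),
        coeFn_mulOp m (indicatorConstLp 2 hs hs' (1 : ℂ))] with x hx hx'
      rw [hx', hx]
      by_cases h : x ∈ s <;> simp [h]
    rw [← h2, setLIntegral_const, ← h1, ← mul_pow]
    gcongr
    exact ContinuousLinearMap.le_opENorm _ _
  rw [Lp.norm_def]
  refine ENNReal.toReal_le_of_le_ofReal (norm_nonneg _) ?_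
  rw [eLpNorm_exponent_top]
  refine essSup_le_of_ae_le _ ?_
  filter_upwards [key] with x hx
  rw [ofReal_norm]
  exact (ENNReal.pow_le_pow_left_iff two_ne_zero).1 hx

end MulOp

/-! ### Unitary changes of variables. -/

section CompEquiv

variable {α β : Type*} [MeasurableSpace α] [MeasurableSpace β] {μ : Measure α} {ν : Measure β}

/-- Composition with an invertible measure-preserving map, as a unitary operator. -/
def compEquiv (f : α → β) (g : β → α) (hf : MeasurePreserving f μ ν)
    (hg : MeasurePreserving g ν μ) (hfg : g ∘ f = id) :
    Lp ℂ 2 ν ≃ₗᵢ[ℂ] Lp ℂ 2 μ :=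
  LinearIsometryEquiv.ofSurjective (Lp.compMeasurePreservingₗᵢ ℂ f hf) fun h => by
    refine ⟨Lp.compMeasurePreserving g hg h, ?_⟩
    change Lp.compMeasurePreserving f hf (Lp.compMeasurePreserving g hg h) = h
    rw [← Lp.compMeasurePreserving_comp_apply]
    refine Lp.ext ((Lp.coeFn_compMeasurePreserving _ _).trans ?_)
    rw [hfg]
    rfl

theorem coeFn_compEquiv (f : α → β) (g : β → α) (hf : MeasurePreserving f μ ν)
    (hg : MeasurePreserving g ν μ) (hfg : g ∘ f = id) (h : Lp ℂ 2 ν) :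
    compEquiv f g hf hg hfg h =ᵐ[μ] h ∘ f :=
  Lp.coeFn_compMeasurePreserving h hf

end CompEquiv

/-! ### The Euclidean Fourier transform on `L¹ ∩ L²`. -/

section Plancherel

open scoped FourierTransform

variable {V : Type*} [NormedAddCommGroup V] [InnerProductSpace ℝ V] [FiniteDimensional ℝ V]
  [MeasurableSpace V] [BorelSpace V]

theorem integral_fourier_mul_eq_of_integrable {f g : V → ℂ} (hf : Integrable f)
    (hg : Integrable g) : ∫ ξ, 𝓕 f ξ * g ξ = ∫ x, f x * 𝓕 g x := by
  have h := VectorFourier.integral_fourierIntegral_smul_eq_flip (L := innerₗ V) (μ := volume)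
    (ν := volume) Real.continuous_fourierChar continuous_inner hf hg
  rw [flip_innerₗ] at h
  exact h

theorem ae_eq_of_integral_schwartz_mul_eq {u v : V → ℂ} (hu : LocallyIntegrable u)
    (hv : LocallyIntegrable v)
    (h : ∀ φ : 𝓢(V, ℂ), ∫ x, φ x * u x = ∫ x, φ x * v x) : u =ᵐ[volume] v := by
  refine ae_eq_of_integral_contDiff_smul_eq hu hv fun g hg hgc => ?_
  have hc : HasCompactSupport (fun x => (g x : ℂ)) := hgc.comp_left (g := ((↑) : ℝ → ℂ)) rfl
  have hd : ContDiff ℝ (⊤ : ℕ∞) (fun x => (g x : ℂ)) := Complex.ofRealCLM.contDiff.comp hg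
  have := h (hc.toSchwartzMap hd)
  simpa using this

/-- The abstract `L²` transform and the Fourier integral define the same tempered distribution, by
the multiplication formula `∫ φ̂ f = ∫ φ f̂`. -/
theorem fourier_lp_ae_eq {f : V → ℂ} (hf : Integrable f) (hf2 : MemLp f 2) :
    (𝓕 (hf2.toLp f) : Lp ℂ 2 (volume : Measure V)) =ᵐ[volume] 𝓕 f := by
  have hcont : Continuous (𝓕 f) :=
    VectorFourier.fourierIntegral_continuous Real.continuous_fourierChar
      (L := innerₗ V) continuous_inner hf
  refine ae_eq_of_integral_schwartz_mul_eq ((Lp.memLp _).locallyIntegrable (by norm_num))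
    hcont.locallyIntegrable fun φ => ?_
  have h1 := congrArg (fun T => T φ) (Lp.fourier_toTemperedDistribution_eq (hf2.toLp f))
  simp only [TemperedDistribution.fourier_apply, Lp.toTemperedDistribution_apply, smul_eq_mul]
    at h1
  rw [← h1]
  have h2 := integral_fourier_mul_eq_of_integrable (φ.integrable (μ := volume)) hf
  rw [← h2, SchwartzMap.fourier_coe]
  refine integral_congr_ae ?_
  filter_upwards [hf2.coeFn_toLp] with x hx
  rw [hx]

/-- Plancherel's formula for functions in `L¹ ∩ L²`. -/
theorem integral_conj_fourier_mul_fourier {f g : V → ℂ} (hf : Integrable f) (hf2 : MemLp f 2)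
    (hg : Integrable g) (hg2 : MemLp g 2) :
    ∫ ξ, 𝓕 g ξ * starRingEnd ℂ (𝓕 f ξ) = ∫ x, g x * starRingEnd ℂ (f x) := by
  have h := Lp.inner_fourier_eq (hf2.toLp f) (hg2.toLp g)
  rw [L2.inner_def, L2.inner_def] at h
  calc _ = _ := integral_congr_ae ?_
    _ = _ := h
    _ = _ := integral_congr_ae ?_
  · filter_upwards [fourier_lp_ae_eq hf hf2, fourier_lp_ae_eq hg hg2] with x h1 h2
    rw [h1, h2]; rfl
  · filter_upwards [hf2.coeFn_toLp, hg2.coeFn_toLp] with x h1 h2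
    rw [h1, h2]; rfl

theorem memLp_two_fourier {f : V → ℂ} (hf : Integrable f) (hf2 : MemLp f 2) :
    MemLp (𝓕 f) 2 :=
  (memLp_congr_ae (fourier_lp_ae_eq hf hf2)).1 (Lp.memLp _)

/-- Injectivity of the Fourier transform on `L¹`. -/
theorem ae_eq_zero_of_fourier_eq_zero {f : V → ℂ} (hf : Integrable f) (h : 𝓕 f = 0) :
    f =ᵐ[volume] 0 := by
  refine ae_eq_of_integral_schwartz_mul_eq hf.locallyIntegrable
    (locallyIntegrable_const 0) fun φ => ?_
  -- Each `φ` is the transform of `𝓕⁻¹ φ`, so `∫ φ f` becomes `∫ (𝓕⁻¹ φ) (𝓕 f) = 0`.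
  have h2 := integral_fourier_mul_eq_of_integrable
    ((FourierTransform.fourierInv φ).integrable (μ := volume)) hf
  rw [← SchwartzMap.fourier_coe, FourierTransform.fourier_fourierInv_eq] at h2
  rw [h2, h]
  simp

end Plancherel

/-! ### Symplectic Fourier multipliers. -/

section Multipliers

open scoped FourierTransform

variable {d : ℕ}

/-- The phase space with its Euclidean norm. -/
abbrev EPhase (d : ℕ) : Type := WithLp 2 (Phase d)

/-- The rotation `(x, ξ) ↦ (ξ, -x)` turning the symplectic form into the inner product. -/
def rotate (z : Phase d) : EPhase d := WithLp.toLp 2 (z.2, -z.1)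

/-- The inverse of `rotate`. -/
def unrotate (w : EPhase d) : Phase d := (-w.ofLp.2, w.ofLp.1)

theorem sympl_eq_inner (ζ z : Phase d) : sympl ζ z = ⟪WithLp.toLp 2 z, rotate ζ⟫_ℝ := by
  rw [WithLp.prod_inner_apply, sympl, rotate]
  simp only [inner_neg_right, sub_eq_add_neg]
  rw [real_inner_comm z.2 ζ.1]

theorem measurePreserving_rotate : MeasurePreserving (rotate (d := d)) := by
  refine (WithLp.volume_preserving_toLp (Config d) (Config d)).comp ?_
  exact (((MeasurePreserving.id volume).prod (Measure.measurePreserving_neg volume)).comp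
    Measure.measurePreserving_swap)

theorem measurePreserving_unrotate : MeasurePreserving (unrotate (d := d)) := by
  refine MeasurePreserving.comp (g := fun z : Phase d => (-z.2, z.1)) ?_
    (WithLp.volume_preserving_ofLp (Config d) (Config d))
  exact (((Measure.measurePreserving_neg volume).prod (MeasurePreserving.id volume)).comp
    Measure.measurePreserving_swap)

theorem unrotate_comp_rotate : unrotate ∘ rotate (d := d) = id := by
  funext z
  simp [rotate, unrotate]

/-- Since `σ(ζ, z)` is the inner product of `z` with the rotated `ζ`, everything about `ℱ_σ` is
inherited from the Euclidean transform on `EPhase d`. -/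
theorem symplFourier_eq_fourier (Ψ : Phase d → ℂ) :
    symplFourier Ψ = 𝓕 (Ψ ∘ WithLp.ofLp : EPhase d → ℂ) ∘ rotate := by
  funext ζ
  rw [Function.comp_apply, Real.fourier_eq', symplFourier,
    ← (WithLp.volume_preserving_ofLp (Config d) (Config d)).integral_comp
      (MeasurableEquiv.toLp 2 _).symm.measurableEmbedding]
  refine integral_congr_ae (Filter.Eventually.of_forall fun v => ?_)
  simp only [sympl_eq_inner, Function.comp_apply, smul_eq_mul, WithLp.toLp_ofLp]
  rw [mul_comm]
  congr 2
  push_cast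
  ring

/-- The symplectic Fourier transform as a unitary operator on `L²(ℝ^{2d})`. -/
def symplFourierL2 (d : ℕ) : L2Phase d ≃ₗᵢ[ℂ] L2Phase d :=
  ((compEquiv WithLp.ofLp (WithLp.toLp 2)
      (WithLp.volume_preserving_ofLp (Config d) (Config d))
      (WithLp.volume_preserving_toLp (Config d) (Config d)) rfl).trans
    (Lp.fourierTransformₗᵢ (EPhase d) ℂ)).trans
  (compEquiv rotate unrotate measurePreserving_rotate measurePreserving_unrotate
    unrotate_comp_rotate)

theorem symplFourierL2_toLp {Ψ : Phase d → ℂ} (h : Integrable Ψ) (h2 : MemLp Ψ 2) :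
    symplFourierL2 d (h2.toLp Ψ) =ᵐ[volume] symplFourier Ψ := by
  refine (coeFn_compEquiv rotate unrotate measurePreserving_rotate measurePreserving_unrotate
    unrotate_comp_rotate _).trans ?_
  rw [symplFourier_eq_fourier]
  refine measurePreserving_rotate.quasiMeasurePreserving.ae_eq_comp ?_
  exact fourier_lp_ae_eq
    ((WithLp.volume_preserving_ofLp (Config d) (Config d)).integrable_comp_of_integrable h)
    (h2.comp_measurePreserving (WithLp.volume_preserving_ofLp (Config d) (Config d)))

theorem integrable_symplFourier_schwartz (Ψ : 𝓢(Phase d, ℂ)) : Integrable (symplFourier Ψ) := by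
  rw [symplFourier_eq_fourier]
  refine measurePreserving_rotate.integrable_comp_of_integrable ?_
  exact (𝓕 (SchwartzMap.compCLMOfContinuousLinearEquiv ℂ
    (WithLp.prodContinuousLinearEquiv 2 ℝ (Config d) (Config d)) Ψ)).integrable

/-- The bounded operator on `L²(ℝ^{2d})` extending `T_m`. -/
def fourierMulL2 (m : LInfPhase d) : L2Phase d →L[ℂ] L2Phase d :=
  -- No inverse on the outside: the kernel `e^{-2πi σ(z, ζ)}` in `T_m` is that of `ℱ_σ` itself.
  (symplFourierL2 d).toContinuousLinearEquiv.toContinuousLinearMap ∘L mulOp m ∘L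
    (symplFourierL2 d).toContinuousLinearEquiv.toContinuousLinearMap

theorem norm_conj_unitary {E F : Type*} [NormedAddCommGroup E] [NormedSpace ℂ E]
    [NormedAddCommGroup F] [NormedSpace ℂ F] (U : E ≃ₗᵢ[ℂ] F) (W : F ≃ₗᵢ[ℂ] E) (M : F →L[ℂ] F) :
    ‖W.toContinuousLinearEquiv.toContinuousLinearMap ∘L M ∘L
      U.toContinuousLinearEquiv.toContinuousLinearMap‖ = ‖M‖ := by
  refine le_antisymm ?_ ?_
  · refine ContinuousLinearMap.opNorm_le_bound _ (norm_nonneg _) fun x => ?_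
    simpa using M.le_opNorm (U x)
  · refine ContinuousLinearMap.opNorm_le_bound _ (norm_nonneg _) fun x => ?_
    have := (W.toContinuousLinearEquiv.toContinuousLinearMap ∘L M ∘L
      U.toContinuousLinearEquiv.toContinuousLinearMap).le_opNorm (U.symm x)
    simpa using this

theorem norm_fourierMulL2 (m : LInfPhase d) : ‖fourierMulL2 m‖ = ‖m‖ :=
  (norm_conj_unitary _ _ _).trans (norm_mulOp m)

/-- For Schwartz `Ψ` the product `m ℱ_σ Ψ` lies in `L¹ ∩ L²`, so the outer unitary is given by the
integral almost everywhere. -/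
theorem extendsFourierMul_fourierMulL2 (m : LInfPhase d) :
    ExtendsFourierMul m (fourierMulL2 m) := by
  intro Ψ
  have hΨ : symplFourierL2 d (Ψ.toLp 2 volume) =ᵐ[volume] symplFourier Ψ :=
    symplFourierL2_toLp Ψ.integrable (Ψ.memLp 2)
  have hm : mulOp m (symplFourierL2 d (Ψ.toLp 2 volume)) =ᵐ[volume]
      fun ζ => m ζ * symplFourier Ψ ζ := by
    filter_upwards [hΨ, coeFn_mulOp m (symplFourierL2 d (Ψ.toLp 2 volume))] with ζ h1 h2
    rw [h2, h1]
  have h2 : MemLp (fun ζ => m ζ * symplFourier Ψ ζ) 2 volume :=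
    (memLp_congr_ae hm).1 (Lp.memLp _)
  have h1 : Integrable (fun ζ => m ζ * symplFourier Ψ ζ) volume :=
    memLp_one_iff_integrable.1
      ((memLp_one_iff_integrable.2 (integrable_symplFourier_schwartz Ψ)).mul (Lp.memLp m))
  have e : mulOp m (symplFourierL2 d (Ψ.toLp 2 volume)) = h2.toLp _ :=
    Lp.ext (hm.trans h2.coeFn_toLp.symm)
  change symplFourierL2 d (mulOp m (symplFourierL2 d (Ψ.toLp 2 volume))) =ᵐ[volume] _
  rw [e]
  exact symplFourierL2_toLp h1 h2

theorem ExtendsFourierMul.unique {m : LInfPhase d} {B B' : L2Phase d →L[ℂ] L2Phase d}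
    (hB : ExtendsFourierMul m B) (hB' : ExtendsFourierMul m B') : B = B' := by
  have hdense : DenseRange (SchwartzMap.toLpCLM ℝ ℂ 2 (volume : Measure (Phase d))) :=
    SchwartzMap.denseRange_toLpCLM (by norm_num)
  refine ContinuousLinearMap.coeFn_injective (hdense.equalizer B.continuous B'.continuous ?_)
  funext Ψ
  exact Lp.ext ((hB Ψ).trans (hB' Ψ).symm)

theorem fourierMultiplierNorm_eq (m : LInfPhase d) : fourierMultiplierNorm m = ‖m‖ := by
  -- By existence and uniqueness of the extension the infimum runs over a single number.
  have : {r | ∃ B : L2Phase d →L[ℂ] L2Phase d, ExtendsFourierMul m B ∧ r = ‖B‖} = {‖m‖} := by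
    ext r
    constructor
    · rintro ⟨B, hB, rfl⟩
      rw [hB.unique (extendsFourierMul_fourierMulL2 m), norm_fourierMulL2]
      rfl
    · rintro rfl
      exact ⟨_, extendsFourierMul_fourierMulL2 m, (norm_fourierMulL2 m).symm⟩
  rw [fourierMultiplierNorm, this, csInf_singleton]

end Multipliers

/-! ### Cross-ambiguity functions: Moyal's identity and totality. -/

section Ambiguity

open scoped FourierTransform

variable {d : ℕ}

/-- The function `t ↦ u(t) conj v(t - x)`. -/
def corr (u v : Config d → ℂ) (x t : Config d) : ℂ := u t * starRingEnd ℂ (v (t - x))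

/-- The cross-ambiguity function `z ↦ ⟨ρ(z) v, u⟩`. -/
def ambFun (u v : L2 d) (z : Phase d) : ℂ := ⟪rho z v, u⟫_ℂ

theorem corr_congr {u u' v v' : Config d → ℂ} (hu : u =ᵐ[volume] u') (hv : v =ᵐ[volume] v')
    (x : Config d) : corr u v x =ᵐ[volume] corr u' v' x := by
  filter_upwards [hu, (measurePreserving_sub_right (volume : Measure (Config d))
    x).quasiMeasurePreserving.ae_eq_comp hv] with t h1 h2
  simp only [Function.comp_apply] at h2
  rw [corr, corr, h1, h2]

theorem ambFun_eq_integral (u v : L2 d) (z : Phase d) :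
    ambFun u v z = ∫ t, u t * starRingEnd ℂ (shiftFun z v t) := by
  rw [ambFun, L2.inner_def]
  refine integral_congr_ae ?_
  filter_upwards [rho_ae_eq z.1 z.2 v] with t ht
  rw [ht]
  rfl

/-- For fixed `x` the ambiguity function is a unimodular phase times a Fourier transform in `t`;
this reduces Moyal's identity to Plancherel on the fibres. -/
theorem ambFun_eq_fourier (u v : L2 d) (x ξ : Config d) :
    ambFun u v (x, ξ) =
      Complex.exp (Real.pi * Complex.I * (⟪x, ξ⟫_ℝ : ℂ)) * 𝓕 (corr u v x) ξ := by
  rw [ambFun_eq_integral, Real.fourier_eq', ← integral_const_mul]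
  congr 1
  funext t
  simp only [shiftFun, map_mul, ← Complex.exp_conj, corr, smul_eq_mul]
  have h (a b c e : ℂ) : a * (b * c * e) = b * (c * (a * e)) := by ring
  rw [h]
  congr 2
  · simp
  · rw [real_inner_comm ξ t]
    congr 1
    simp [Complex.conj_ofNat]
    ring

theorem norm_ambFun_eq (u v : L2 d) (x ξ : Config d) :
    ‖ambFun u v (x, ξ)‖ = ‖𝓕 (corr u v x) ξ‖ := by
  rw [ambFun_eq_fourier, norm_mul, Complex.norm_exp]
  simp

theorem stronglyMeasurable_ambFun (u v : L2 d) : StronglyMeasurable (ambFun u v) := by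
  rw [funext (ambFun_eq_integral u v)]
  refine StronglyMeasurable.integral_prod_right (f := fun z t => u t * starRingEnd ℂ (shiftFun z v t))
    ?_
  refine Measurable.stronglyMeasurable ?_
  have hu := (Lp.stronglyMeasurable u).measurable
  have hv := (Lp.stronglyMeasurable v).measurable
  refine (hu.comp measurable_snd).mul (Complex.continuous_conj.measurable.comp ?_)
  refine Measurable.mul ?_ (hv.comp (by fun_prop))
  exact Continuous.measurable (by fun_prop)

/-- This change of variables decouples `u(t) conj v(t - x)` into a tensor product. -/
theorem measurePreserving_shear :
    MeasurePreserving (fun p : Phase d => (p.2, p.2 - p.1)) volume volume := by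
  have := (measurePreserving_add_prod (volume : Measure (Config d)) volume).comp
    (measurePreserving_prod_sub (volume : Measure (Config d)) volume)
  have e : (fun p : Phase d => (p.2, p.2 - p.1)) =
      (fun z : Phase d => (z.1 + z.2, z.2)) ∘ fun z : Phase d => (z.1, z.2 - z.1) := by
    funext p
    simp
  rw [e]
  exact this

theorem measurable_corr (u v : L2 d) : Measurable (fun p : Phase d => corr u v p.1 p.2) := by
  have hu := (Lp.stronglyMeasurable u).measurable
  have hv := (Lp.stronglyMeasurable v).measurable
  exact (hu.comp measurable_snd).mul (Complex.continuous_conj.measurable.comp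
    (hv.comp (by fun_prop)))

theorem memLp_conj {α : Type*} [MeasurableSpace α] {μ : Measure α} {f : α → ℂ} {p : ℝ≥0∞}
    (hf : MemLp f p μ) : MemLp (fun t => starRingEnd ℂ (f t)) p μ :=
  hf.of_le (Complex.continuous_conj.comp_aestronglyMeasurable hf.1)
    (Filter.Eventually.of_forall fun t => by simp)

theorem integrable_mul_conj {α : Type*} [MeasurableSpace α] {μ : Measure α} {f g : α → ℂ}
    (hf : MemLp f 2 μ) (hg : MemLp g 2 μ) : Integrable (fun t => f t * starRingEnd ℂ (g t)) μ :=
  hf.integrable_mul (memLp_conj hg)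

theorem integrable_corr (u v : L2 d) (x : Config d) : Integrable (corr u v x) :=
  integrable_mul_conj (Lp.memLp u)
    ((Lp.memLp v).comp_measurePreserving (measurePreserving_sub_right volume x))

theorem memLp_corr_prod (u v : L2 d) :
    MemLp (fun p : Phase d => corr u v p.1 p.2) 2 (volume : Measure (Phase d)) := by
  rw [memLp_two_iff_integrable_sq_norm (measurable_corr u v).aestronglyMeasurable]
  have h1 := (memLp_two_iff_integrable_sq_norm (Lp.aestronglyMeasurable u)).1 (Lp.memLp u)
  have h2 := (memLp_two_iff_integrable_sq_norm (Lp.aestronglyMeasurable v)).1 (Lp.memLp v)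
  have h3 : Integrable (fun z : Phase d => ‖u z.1‖ ^ 2 * ‖v z.2‖ ^ 2) volume := h1.mul_prod h2
  refine (measurePreserving_shear.integrable_comp_of_integrable h3).congr
    (Filter.Eventually.of_forall fun p => ?_)
  simp [corr, mul_pow]

/-- By Fubini. Fibres are in `L¹` for every `x`, but square integrability, needed for Plancherel, is
obtained only for almost every `x`. -/
theorem ae_memLp_corr (u v : L2 d) : ∀ᵐ x : Config d, MemLp (corr u v x) 2 volume := by
  have h := (memLp_two_iff_integrable_sq_norm (measurable_corr u v).aestronglyMeasurable).1
    (memLp_corr_prod u v)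
  filter_upwards [((integrable_prod_iff h.aestronglyMeasurable).1 h).1] with x hx
  exact (memLp_two_iff_integrable_sq_norm (integrable_corr u v x).aestronglyMeasurable).2 hx

theorem memLp_ambFun (u v : L2 d) : MemLp (ambFun u v) 2 (volume : Measure (Phase d)) := by
  have hm := (stronglyMeasurable_ambFun u v).aestronglyMeasurable (μ := volume)
  rw [memLp_two_iff_integrable_sq_norm hm]
  have h := (memLp_two_iff_integrable_sq_norm (measurable_corr u v).aestronglyMeasurable).1
    (memLp_corr_prod u v)
  refine (integrable_prod_iff ((stronglyMeasurable_ambFun u v).norm.pow 2).aestronglyMeasurable).2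
    ⟨?_, ?_⟩
  · filter_upwards [ae_memLp_corr u v] with x hx
    have h2 := memLp_two_fourier (integrable_corr u v x) hx
    refine ((memLp_two_iff_integrable_sq_norm h2.1).1 h2).congr
      (Filter.Eventually.of_forall fun ξ => ?_)
    exact congrArg (· ^ 2) (norm_ambFun_eq u v x ξ).symm
  · refine ((integrable_prod_iff h.aestronglyMeasurable).1 h).2.congr ?_
    filter_upwards [ae_memLp_corr u v] with x hx
    have h3 := integral_conj_fourier_mul_fourier (integrable_corr u v x) hx
      (integrable_corr u v x) hx
    simp only [Complex.mul_conj, Complex.normSq_eq_norm_sq, integral_complex_ofReal] at h3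
    have h4 : _ = _ := Complex.ofReal_injective h3
    simpa [norm_ambFun_eq] using h4.symm

/-- The cross-ambiguity function as an element of `L²(ℝ^{2d})`. -/
def amb (u v : L2 d) : L2Phase d := (memLp_ambFun u v).toLp _

theorem coeFn_amb (u v : L2 d) : amb u v =ᵐ[volume] ambFun u v := MemLp.coeFn_toLp _

theorem inner_amb_eq_integral (u v : L2 d) (F : L2Phase d) :
    ⟪amb u v, F⟫_ℂ = ∫ z, F z * starRingEnd ℂ (ambFun u v z) := by
  rw [L2.inner_def]
  refine integral_congr_ae ?_
  filter_upwards [coeFn_amb u v] with z hz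
  rw [hz]
  rfl

/-- Moyal's identity. -/
theorem inner_amb_amb (u v u' v' : L2 d) :
    ⟪amb u' v', amb u v⟫_ℂ = ⟪u', u⟫_ℂ * ⟪v, v'⟫_ℂ := by
  have hint : Integrable (fun z => ambFun u v z * starRingEnd ℂ (ambFun u' v' z))
      ((volume : Measure (Config d)).prod volume) :=
    integrable_mul_conj (memLp_ambFun u v) (memLp_ambFun u' v')
  have hint' : Integrable (fun z : Phase d => corr u v z.1 z.2 *
      starRingEnd ℂ (corr u' v' z.1 z.2)) ((volume : Measure (Config d)).prod volume) :=
    integrable_mul_conj (memLp_corr_prod u v) (memLp_corr_prod u' v')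
  calc ⟪amb u' v', amb u v⟫_ℂ
      = ∫ z, ambFun u v z * starRingEnd ℂ (ambFun u' v' z) := by
        rw [inner_amb_eq_integral]
        refine integral_congr_ae ?_
        filter_upwards [coeFn_amb u v] with z hz
        rw [hz]
    _ = ∫ x, ∫ ξ, ambFun u v (x, ξ) * starRingEnd ℂ (ambFun u' v' (x, ξ)) :=
        integral_prod _ hint
    -- Plancherel in `ξ`; the two phases depend only on `(x, ξ)` and cancel.
    _ = ∫ x, ∫ t, corr u v x t * starRingEnd ℂ (corr u' v' x t) := by
        refine integral_congr_ae ?_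
        filter_upwards [ae_memLp_corr u v, ae_memLp_corr u' v'] with x h h'
        rw [← integral_conj_fourier_mul_fourier (integrable_corr u' v' x) h'
          (integrable_corr u v x) h]
        congr 1
        funext ξ
        rw [ambFun_eq_fourier, ambFun_eq_fourier, map_mul, mul_mul_mul_comm, Complex.mul_conj,
          Complex.normSq_eq_norm_sq, Complex.norm_exp]
        simp
    _ = ∫ z : Phase d, corr u v z.1 z.2 * starRingEnd ℂ (corr u' v' z.1 z.2) :=
        (integral_prod _ hint').symm
    _ = ∫ z : Phase d, (u z.1 * starRingEnd ℂ (u' z.1)) * (v' z.2 * starRingEnd ℂ (v z.2)) := by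
        have hm : AEStronglyMeasurable (fun z : Phase d =>
            (u z.1 * starRingEnd ℂ (u' z.1)) * (v' z.2 * starRingEnd ℂ (v z.2)))
            (Measure.map (fun p : Phase d => (p.2, p.2 - p.1)) volume) := by
          rw [measurePreserving_shear.map_eq]
          exact ((integrable_mul_conj (Lp.memLp u) (Lp.memLp u')).mul_prod
            (integrable_mul_conj (Lp.memLp v') (Lp.memLp v))).aestronglyMeasurable
        conv_rhs => rw [← measurePreserving_shear.map_eq]
        rw [integral_map measurePreserving_shear.measurable.aemeasurable hm]
        congr 1
        funext z
        simp only [corr, map_mul, Complex.conj_conj]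
        ring
    _ = ⟪u', u⟫_ℂ * ⟪v, v'⟫_ℂ := by
        rw [L2.inner_def, L2.inner_def]
        exact integral_prod_mul (fun t => u t * starRingEnd ℂ (u' t))
          (fun t => v' t * starRingEnd ℂ (v t))

theorem corr_rho_rho (y η : Config d) (u v : L2 d) (x : Config d) :
    corr (rho (y, η) u) (rho (y, η) v) x =ᵐ[volume]
      fun t => Complex.exp (2 * Real.pi * Complex.I * (⟪η, x⟫_ℝ : ℂ)) * corr u v x (t - y) := by
  refine (corr_congr (rho_ae_eq y η u) (rho_ae_eq y η v) x).trans
    (Filter.Eventually.of_forall fun t => ?_)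
  simp only [corr, map_mul, ← Complex.exp_conj, sub_right_comm t x y]
  have : Complex.exp (2 * Real.pi * Complex.I * (⟪η, x⟫_ℝ : ℂ)) =
      Complex.exp (-Real.pi * Complex.I * (⟪y, η⟫_ℝ : ℂ)) *
      Complex.exp (2 * Real.pi * Complex.I * (⟪η, t⟫_ℝ : ℂ)) *
      (Complex.exp (starRingEnd ℂ (-Real.pi * Complex.I * (⟪y, η⟫_ℝ : ℂ))) *
      Complex.exp (starRingEnd ℂ (2 * Real.pi * Complex.I * (⟪η, t - x⟫_ℝ : ℂ)))) := by
    rw [← Complex.exp_add, ← Complex.exp_add, ← Complex.exp_add]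
    congr 1
    simp [inner_sub_right, Complex.conj_ofNat]
    ring
  simp only [map_mul, map_neg] at this ⊢
  rw [this]
  ring

theorem fourier_congr_ae {f g : Config d → ℂ} (h : f =ᵐ[volume] g) : 𝓕 f = 𝓕 g := by
  funext ξ
  rw [Real.fourier_eq', Real.fourier_eq']
  refine integral_congr_ae ?_
  filter_upwards [h] with t ht
  rw [ht]

theorem fourier_const_mul_comp_sub (c : ℂ) (f : Config d → ℂ) (y ξ : Config d) :
    𝓕 (fun t => c * f (t - y)) ξ =
      c * Complex.exp (-2 * Real.pi * Complex.I * (⟪y, ξ⟫_ℝ : ℂ)) * 𝓕 f ξ := by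
  rw [Real.fourier_eq', Real.fourier_eq', ← integral_add_right_eq_self _ y, ← integral_const_mul]
  congr 1
  funext t
  simp only [smul_eq_mul, inner_add_left, add_sub_cancel_right]
  have h (a b c e : ℂ) : a * b * (c * e) = (b * c) * (a * e) := by ring
  rw [h, ← Complex.exp_add]
  congr 2
  push_cast
  ring

/-- Shifting both arguments by `ρ(w)` only modulates by a symplectic character, so pairings with
shifted pairs are values of a symplectic Fourier transform. -/
theorem ambFun_rho_rho (w z : Phase d) (u v : L2 d) :
    ambFun (rho w u) (rho w v) z =
      Complex.exp (2 * Real.pi * Complex.I * (sympl w z : ℂ)) * ambFun u v z := by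
  obtain ⟨y, η⟩ := w
  obtain ⟨x, ξ⟩ := z
  rw [ambFun_eq_fourier, ambFun_eq_fourier, fourier_congr_ae (corr_rho_rho y η u v x),
    fourier_const_mul_comp_sub, ← mul_assoc, ← mul_assoc, ← mul_assoc, ← Complex.exp_add,
    ← Complex.exp_add, ← Complex.exp_add]
  congr 2
  simp only [sympl]
  rw [real_inner_comm x η]
  push_cast
  ring

theorem rotate_unrotate (ζ : EPhase d) : rotate (unrotate ζ) = ζ := by
  simp only [rotate, unrotate, neg_neg]

theorem ae_eq_zero_of_symplFourier_eq_zero {Ψ : Phase d → ℂ} (hΨ : Integrable Ψ)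
    (h : ∀ w, symplFourier Ψ w = 0) : Ψ =ᵐ[volume] 0 := by
  have h1 : 𝓕 (Ψ ∘ WithLp.ofLp : EPhase d → ℂ) = 0 := by
    funext ζ
    have h2 := h (unrotate ζ)
    rw [symplFourier_eq_fourier, Function.comp_apply,
      rotate_unrotate] at h2
    exact h2
  have h3 := ae_eq_zero_of_fourier_eq_zero
    ((WithLp.volume_preserving_ofLp (Config d) (Config d)).integrable_comp_of_integrable hΨ) h1
  exact (WithLp.volume_preserving_toLp (Config d)
    (Config d)).quasiMeasurePreserving.ae_eq_comp h3

theorem memLp_gaussian (d : ℕ) :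
    MemLp (fun t : Config d => Complex.exp (-Real.pi * ‖t‖ ^ 2)) 2 volume := by
  rw [memLp_two_iff_integrable_sq_norm (Continuous.aestronglyMeasurable (by fun_prop))]
  have h := (GaussianFourier.integrable_cexp_neg_mul_sq_norm_add (V := Config d)
    (b := (2 * Real.pi : ℝ)) (by simp [Real.pi_pos]) 0 0).norm
  refine h.congr (Filter.Eventually.of_forall fun t => ?_)
  simp only [Complex.norm_exp, ← Real.exp_nat_mul]
  congr 1
  simp [← Complex.ofReal_pow]
  ring

/-- The Gaussian `t ↦ e^{-π |t|²}`. -/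
def gaussian (d : ℕ) : L2 d := (memLp_gaussian d).toLp _

/-- Completing the square, `|t|² + |t - x|² = 2|t - x/2|² + |x|²/2`: the correlation is a translated
Gaussian, whose transform has no zeros. -/
theorem ambFun_gaussian_ne_zero (z : Phase d) : ambFun (gaussian d) (gaussian d) z ≠ 0 := by
  obtain ⟨x, ξ⟩ := z
  have hc : corr (gaussian d) (gaussian d) x =ᵐ[volume] fun t =>
      Complex.exp (-(Real.pi / 2) * ‖x‖ ^ 2) *
        Complex.exp (-((2 * Real.pi : ℝ) : ℂ) * ‖t - (2⁻¹ : ℝ) • x‖ ^ 2) := by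
    refine (corr_congr (memLp_gaussian d).coeFn_toLp (memLp_gaussian d).coeFn_toLp x).trans
      (Filter.Eventually.of_forall fun t => ?_)
    simp only [corr, ← Complex.exp_conj, ← Complex.exp_add]
    congr 1
    simp only [← Complex.ofReal_pow, norm_sub_sq_real, norm_smul, inner_smul_right]
    simp [mul_pow, Complex.conj_ofNat]
    ring
  rw [ambFun_eq_fourier, fourier_congr_ae hc]
  rw [fourier_const_mul_comp_sub _ (fun t => Complex.exp (-((2 * Real.pi : ℝ) : ℂ) * ‖t‖ ^ 2)),
    fourier_gaussian_innerProductSpace (by simp [Real.pi_pos])]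
  simp [Complex.exp_ne_zero, Complex.cpow_eq_zero_iff]

/-- The cross-ambiguity functions are total in `L²(ℝ^{2d})`. -/
theorem eq_zero_of_inner_amb_eq_zero {F : L2Phase d} (h : ∀ u v : L2 d, ⟪amb u v, F⟫_ℂ = 0) :
    F = 0 := by
  set g := gaussian d
  have hint : Integrable (fun z => F z * starRingEnd ℂ (ambFun g g z)) volume :=
    integrable_mul_conj (Lp.memLp F) (memLp_ambFun g g)
  -- The pairing of `F` with `A(ρ(w) g, ρ(w) g)` is `ℱ_σ (F · conj A(g, g))(w)`. It vanishes for all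
  -- `w`, and `A(g, g)` can then be divided out.
  have h0 := ae_eq_zero_of_symplFourier_eq_zero hint fun w => by
    rw [← h (rho w g) (rho w g), inner_amb_eq_integral, symplFourier]
    congr 1
    funext z
    rw [ambFun_rho_rho, map_mul, ← Complex.exp_conj]
    simp only [map_mul, Complex.conj_I, Complex.conj_ofReal, Complex.conj_ofNat]
    rw [mul_assoc, mul_comm (starRingEnd ℂ _)]
    congr 3
    ring
  refine Lp.ext ?_
  filter_upwards [h0, Lp.coeFn_zero ℂ 2 (volume : Measure (Phase d))] with z hz hz'
  rw [hz']
  have := ambFun_gaussian_ne_zero z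
  simpa [this, g] using hz

theorem eq_of_inner_amb_eq {F G : L2Phase d} (h : ∀ u v : L2 d, ⟪amb u v, F⟫_ℂ = ⟪amb u v, G⟫_ℂ) :
    F = G :=
  sub_eq_zero.1 <| eq_zero_of_inner_amb_eq_zero fun u v => by rw [inner_sub_right, h, sub_self]

end Ambiguity

/-! ### The unitary Fourier-Wigner transform on `𝒮²` and its multipliers. -/

section HilbertSchmidt

variable {d : ℕ}

theorem amb_add (u u' v : L2 d) : amb (u + u') v = amb u v + amb u' v :=
  eq_of_inner_amb_eq fun a b => by simp only [inner_add_right, inner_amb_amb, add_mul]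

theorem amb_smul (c : ℂ) (u v : L2 d) : amb (c • u) v = c • amb u v :=
  eq_of_inner_amb_eq fun a b => by simp only [inner_smul_right, inner_amb_amb, mul_assoc]

theorem amb_add_right (u v v' : L2 d) : amb u (v + v') = amb u v + amb u v' :=
  eq_of_inner_amb_eq fun a b => by
    simp only [inner_add_left, inner_add_right, inner_amb_amb, mul_add]

theorem amb_smul_right (c : ℂ) (u v : L2 d) : amb u (c • v) = starRingEnd ℂ c • amb u v :=
  eq_of_inner_amb_eq fun a b => by
    simp only [inner_smul_right, inner_smul_left, inner_amb_amb]
    ring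

theorem norm_amb (u v : L2 d) : ‖amb u v‖ = ‖u‖ * ‖v‖ := by
  have h := inner_amb_amb u v u v
  rw [inner_self_eq_norm_sq_to_K, inner_self_eq_norm_sq_to_K, inner_self_eq_norm_sq_to_K,
    ← mul_pow] at h
  have h2 : ‖amb u v‖ ^ 2 = (‖u‖ * ‖v‖) ^ 2 := by exact_mod_cast h
  exact (pow_left_inj₀ (norm_nonneg _) (by positivity) two_ne_zero).1 h2

/-- The isometry `u ↦ A(u, eᵢ)`. -/
def ambIsometry (i : onbIndex d) : L2 d →ₗᵢ[ℂ] L2Phase d where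
  toFun u := amb u (onb d i)
  map_add' u u' := amb_add u u' _
  map_smul' c u := amb_smul c u _
  norm_map' u := by
    change ‖amb u (onb d i)‖ = _
    rw [norm_amb, (onb d).orthonormal.1, mul_one]

theorem isHilbertSum_ambIsometry (d : ℕ) :
    IsHilbertSum ℂ (fun _ : onbIndex d => L2 d) (ambIsometry (d := d)) := by
  refine IsHilbertSum.mk (fun i j hij u v => ?_) ?_
  · change ⟪amb u (onb d i), amb v (onb d j)⟫_ℂ = 0
    rw [inner_amb_amb, (onb d).orthonormal.2 hij.symm, mul_zero]
  · rw [top_le_iff, Submodule.topologicalClosure_eq_top_iff, Submodule.eq_bot_iff]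
    intro F hF
    refine eq_zero_of_inner_amb_eq_zero fun u v => ?_
    -- Both the second slot of `amb` and the first slot of the inner product are conjugate-linear,
    -- so this is linear in `v`. Vanishing on the basis, it vanishes identically, and totality
    -- applies.
    let L : L2 d →L[ℂ] ℂ := LinearMap.mkContinuous
      { toFun := fun v => ⟪amb u v, F⟫_ℂ
        map_add' := fun v v' => by rw [amb_add_right, inner_add_left]
        map_smul' := fun c v => by simp [amb_smul_right, inner_smul_left] }
      (‖u‖ * ‖F‖) fun v => by
        refine (norm_inner_le_norm (𝕜 := ℂ) (amb u v) F).trans_eq ?_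
        rw [norm_amb]
        ring
    have hL : L = 0 := by
      refine ContinuousLinearMap.ext_on
        (Submodule.dense_iff_topologicalClosure_eq_top.mpr (onb d).dense_span) ?_
      rintro _ ⟨i, rfl⟩
      exact hF _ (Submodule.mem_iSup_of_mem i ⟨u, rfl⟩)
    exact congrArg (fun T : L2 d →L[ℂ] ℂ => T v) hL

theorem hasSum_norm_sq_inner {ι : Type*} (b : HilbertBasis ι ℂ (L2 d)) (f : L2 d) :
    HasSum (fun i => ‖⟪b i, f⟫_ℂ‖ ^ 2) (‖f‖ ^ 2) := by
  have h3 := Complex.hasSum_re (b.hasSum_inner_mul_inner f f)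
  have e1 : (⟪f, f⟫_ℂ).re = ‖f‖ ^ 2 := inner_self_eq_norm_sq (𝕜 := ℂ) f
  rw [e1] at h3
  refine h3.congr_fun fun i => ?_
  rw [← inner_conj_symm f (b i), mul_comm, Complex.mul_conj, Complex.normSq_eq_norm_sq]
  exact (Complex.ofReal_re _).symm

/-- For square summable `(vᵢ)` the operator `f ↦ ∑ ⟨eᵢ, f⟩ vᵢ` converges absolutely and is bounded
by Cauchy-Schwarz. -/
theorem S2.coords_surjective (d : ℕ) : Function.Surjective (S2.coords d) := by
  classical
  intro v
  have hv : HasSum (fun i => ‖v i‖ ^ 2) (‖v‖ ^ 2) := by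
    have h := lp.hasSum_norm (p := 2) (by norm_num) v
    simpa using h
  have hcs (f : L2 d) : Summable (fun i => ‖⟪onb d i, f⟫_ℂ‖ * ‖v i‖) ∧
      ∑' i, ‖⟪onb d i, f⟫_ℂ‖ * ‖v i‖ ≤ ‖f‖ * ‖v‖ := by
    have hf := hasSum_norm_sq_inner (onb d) f
    have h := Real.summable_and_inner_le_Lp_mul_Lq_tsum_of_nonneg Real.HolderConjugate.two_two
      (f := fun i => ‖⟪onb d i, f⟫_ℂ‖) (g := fun i => ‖v i‖)
      (fun i => norm_nonneg _) (fun i => norm_nonneg _)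
      (by simpa using hf.summable) (by simpa using hv.summable)
    refine ⟨h.1, h.2.trans_eq ?_⟩
    simp only [Real.rpow_two, hf.tsum_eq, hv.tsum_eq, ← Real.sqrt_eq_rpow]
    rw [Real.sqrt_sq (norm_nonneg _), Real.sqrt_sq (norm_nonneg _)]
  have hsum (f : L2 d) : Summable (fun i => ⟪onb d i, f⟫_ℂ • v i) :=
    Summable.of_norm (by simpa only [norm_smul] using (hcs f).1)
  let T : Op d := LinearMap.mkContinuous
    { toFun := fun f => ∑' i, ⟪onb d i, f⟫_ℂ • v i
      map_add' := fun f g => by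
        rw [← (hsum f).tsum_add (hsum g)]
        simp only [inner_add_right, add_smul]
      map_smul' := fun c f => by
        rw [RingHom.id_apply, ← (hsum f).tsum_const_smul]
        simp only [inner_smul_right, mul_smul] }
    ‖v‖ fun f => by
      refine (norm_tsum_le_tsum_norm (by simpa only [norm_smul] using (hcs f).1)).trans ?_
      simp only [norm_smul]
      rw [mul_comm]
      exact (hcs f).2
  have hT (i : onbIndex d) : T (onb d i) = v i := by
    change ∑' j, ⟪onb d j, onb d i⟫_ℂ • v j = v i
    rw [tsum_eq_single i]
    · simp [(onb d).orthonormal.1]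
    · intro j hj
      rw [(onb d).orthonormal.2 hj, zero_smul]
  have hmem : T ∈ hilbertSchmidtSubmodule d := by
    change Memℓp (fun i => T (onb d i)) 2
    simp only [hT]
    exact lp.memℓp v
  refine ⟨(⟨T, hmem⟩ : hilbertSchmidtSubmodule d), ?_⟩
  exact lp.ext (funext hT)

/-- `S2.coords` as a unitary operator. -/
def S2.coordsEquiv (d : ℕ) : S2 d ≃ₗᵢ[ℂ] lp (fun _ : onbIndex d => L2 d) 2 :=
  LinearIsometryEquiv.ofSurjective ⟨S2.coords d, fun _ => rfl⟩ (S2.coords_surjective d)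

/-- The Fourier-Wigner transform as a unitary operator `𝒮² → L²(ℝ^{2d})`. -/
def fourierWignerL2 (d : ℕ) : S2 d ≃ₗᵢ[ℂ] L2Phase d :=
  (S2.coordsEquiv d).trans (isHilbertSum_ambIsometry d).linearIsometryEquiv.symm

theorem hasSum_fourierWignerL2 (S : S2 d) :
    HasSum (fun i => amb (S.toOp (onb d i)) (onb d i)) (fourierWignerL2 d S) :=
  (isHilbertSum_ambIsometry d).hasSum_linearIsometryEquiv_symm (S2.coordsEquiv d S)

/-- Both sides are `∑ ⟨g, S eᵢ⟩ ⟨eᵢ, f⟩`, by Moyal on the left and by expanding `f` on the right. As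
`conj A(g, f)(z) = ⟨g, ρ(z) f⟩`, this is weak Fourier-Wigner inversion. -/
theorem inner_amb_fourierWignerL2 (g f : L2 d) (S : S2 d) :
    ⟪amb g f, fourierWignerL2 d S⟫_ℂ = ⟪g, S.toOp f⟫_ℂ := by
  have h1 : HasSum (fun i => ⟪g, S.toOp (onb d i)⟫_ℂ * ⟪onb d i, f⟫_ℂ)
      ⟪amb g f, fourierWignerL2 d S⟫_ℂ := by
    have h := (hasSum_fourierWignerL2 S).mapL (innerSL ℂ (amb g f))
    simpa only [innerSL_apply_apply, inner_amb_amb] using h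
  have h2 : HasSum (fun i => ⟪g, S.toOp (onb d i)⟫_ℂ * ⟪onb d i, f⟫_ℂ) ⟪g, S.toOp f⟫_ℂ := by
    have h := (((onb d).hasSum_repr f).mapL S.toOp).mapL (innerSL ℂ g)
    rw [innerSL_apply_apply] at h
    refine h.congr_fun fun i => ?_
    rw [map_smul, map_smul, innerSL_apply_apply, HilbertBasis.repr_apply_apply, smul_eq_mul]
    exact mul_comm _ _
  exact h1.unique h2

theorem S2.ext_inner {S T : S2 d} (h : ∀ f g : L2 d, ⟪g, S.toOp f⟫_ℂ = ⟪g, T.toOp f⟫_ℂ) :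
    S = T :=
  (fourierWignerL2 d).injective <| eq_of_inner_amb_eq fun g f => by
    rw [inner_amb_fourierWignerL2, inner_amb_fourierWignerL2, h]

theorem tsum_norm_inner_mul_inner_le {ι : Type*} (b : HilbertBasis ι ℂ (L2 d)) (x y : L2 d) :
    ∑' i, ‖⟪x, b i⟫_ℂ * ⟪b i, y⟫_ℂ‖ ≤ (‖x‖ ^ 2 + ‖y‖ ^ 2) / 2 := by
  have h := ((hasSum_norm_sq_inner b x).add (hasSum_norm_sq_inner b y)).div_const 2
  rw [← h.tsum_eq]
  refine (b.summable_inner_mul_inner x y).norm.tsum_le_tsum (fun i => ?_) h.summable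
  rw [norm_mul, norm_inner_symm x]
  nlinarith [sq_nonneg (‖⟪b i, x⟫_ℂ‖ - ‖⟪b i, y⟫_ℂ‖)]

theorem norm_rho (z : Phase d) (f : L2 d) : ‖rho z f‖ = ‖f‖ := (rhoIsometry z).norm_map f

/-- The trace and the singular series may be interchanged: the double series is absolutely summable,
the `n`-th inner sum being at most `s n` for unit vectors. -/
theorem hasSum_fourierWigner {ι : Type*} {s : ι → ℝ} {e η : ι → L2 d} {T : Op d}
    (hs : ∀ n, 0 ≤ s n) (hsum : Summable s) (he : Orthonormal ℂ e) (hη : Orthonormal ℂ η)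
    (hT : HasSum (fun n => (s n : ℂ) • InnerProductSpace.rankOne ℂ (e n) (η n)) T) (z : Phase d) :
    HasSum (fun n => (s n : ℂ) * ambFun (e n) (η n) z) (fourierWigner T z) := by
  let a : ι → onbIndex d → ℂ := fun n i =>
    (s n : ℂ) * (⟪rho z (η n), onb d i⟫_ℂ * ⟪onb d i, e n⟫_ℂ)
  have hrow (i : onbIndex d) :
      HasSum (fun n => a n i) ⟪onb d i, (T ∘L (rho z).adjoint) (onb d i)⟫_ℂ := by
    have h := (hT.mapL (ContinuousLinearMap.apply ℂ (L2 d) ((rho z).adjoint (onb d i)))).mapL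
      (innerSL ℂ (onb d i))
    refine h.congr_fun fun n => ?_
    simp [a, ContinuousLinearMap.adjoint_inner_right]
  have hcol (n : ι) : HasSum (fun i => a n i) ((s n : ℂ) * ambFun (e n) (η n) z) :=
    ((onb d).hasSum_inner_mul_inner _ _).mul_left _
  have hnorm : Summable (fun p : ι × onbIndex d => ‖a p.1 p.2‖) := by
    refine (summable_prod_of_nonneg fun _ => norm_nonneg _).2 ⟨fun n => (hcol n).summable.norm, ?_⟩
    refine Summable.of_nonneg_of_le (fun n => tsum_nonneg fun _ => norm_nonneg _) (fun n => ?_) hsum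
    have h := tsum_norm_inner_mul_inner_le (onb d) (rho z (η n)) (e n)
    rw [norm_rho, hη.1, he.1] at h
    simp only [a, norm_mul (s n : ℂ), tsum_mul_left, Complex.norm_real, Real.norm_of_nonneg (hs n)]
    refine mul_le_of_le_one_right (hs n) (h.trans_eq (by norm_num))
  have hsumm : Summable (Function.uncurry a) := hnorm.of_norm
  have h1 : fourierWigner T z = ∑' n, ∑' i, a n i := by
    rw [fourierWigner, trace, ← hsumm.tsum_comm]
    exact tsum_congr fun i => (hrow i).tsum_eq.symm
  rw [h1]
  have h2 := hsumm.prod.hasSum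
  simp only [Function.uncurry_apply_pair] at h2
  exact h2.congr_fun fun n => (hcol n).tsum_eq.symm

/-- A series converging both in `L²` and pointwise has the same sum in both senses. -/
theorem ae_eq_of_hasSum_lp {α ι : Type*} [MeasurableSpace α] {μ : Measure α} [Countable ι]
    {F : ι → Lp ℂ 2 μ} {Φ : Lp ℂ 2 μ} {f : ι → α → ℂ} {φ : α → ℂ} (hF : HasSum F Φ)
    (hf : ∀ x, HasSum (fun n => f n x) (φ x)) (hFf : ∀ n, F n =ᵐ[μ] f n) : Φ =ᵐ[μ] φ := by
  -- `L²` convergence gives convergence in measure, hence almost everywhere along a sequence of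
  -- finite partial sums.
  obtain ⟨ns, hns, h⟩ := (tendstoInMeasure_of_tendsto_Lp hF).exists_seq_tendsto_ae'
  have hfin (s : Finset ι) : (∑ n ∈ s, F n : Lp ℂ 2 μ) =ᵐ[μ] fun x => ∑ n ∈ s, f n x := by
    filter_upwards [Lp.coeFn_finsetSum s F, ae_all_iff.2 hFf] with x h1 h2
    rw [h1]
    simp [h2]
  filter_upwards [h, ae_all_iff.2 fun n => hfin (ns n)] with x h1 h2
  refine tendsto_nhds_unique h1 ?_
  simp only [h2]
  exact (hf x).comp hns

theorem fourierWignerL2_ae_eq {T : S2 d} (hT : IsTraceClass T.toOp) :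
    fourierWignerL2 d T =ᵐ[volume] fourierWigner T.toOp := by
  obtain ⟨ι, s, e, η, hs, hsum, he, hη, hT⟩ := hT
  have hF : HasSum (fun n => (s n : ℂ) • amb (e n) (η n)) (fourierWignerL2 d T) := by
    have h1 : Summable (fun n => (s n : ℂ) • amb (e n) (η n)) := by
      refine Summable.of_norm (hsum.congr fun n => ?_)
      rw [norm_smul, norm_amb, he.1, hη.1, Complex.norm_real, Real.norm_of_nonneg (hs n)]
      ring
    -- The singular series is only given to converge in operator norm, which suffices to identify
    -- the `L²` sum by pairing with ambiguity functions.
    have h2 : ∑' n, (s n : ℂ) • amb (e n) (η n) = fourierWignerL2 d T := by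
      refine eq_of_inner_amb_eq fun g f => ?_
      rw [inner_amb_fourierWignerL2]
      refine (h1.hasSum.mapL (innerSL ℂ (amb g f))).unique ?_
      have h3 := (hT.mapL (ContinuousLinearMap.apply ℂ (L2 d) f)).mapL (innerSL ℂ g)
      refine h3.congr_fun fun n => ?_
      simp [inner_amb_amb, mul_comm]
    exact h2 ▸ h1.hasSum
  -- The index type may be uncountable; almost-everywhere arguments need the countable support.
  have hc : Countable (Function.support s) := hsum.countable_support
  refine ae_eq_of_hasSum_lp (ι := Function.support s)
    (f := fun n z => (s n : ℂ) * ambFun (e n) (η n) z)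
    ((hasSum_subtype_iff_of_support_subset ?_).2 hF)
    (fun z => (hasSum_subtype_iff_of_support_subset
      (f := fun n => (s n : ℂ) * ambFun (e n) (η n) z) ?_).2
      (hasSum_fourierWigner hs hsum he hη hT z)) fun n => ?_
  · intro n hn h0
    exact hn (by simp [h0])
  · intro n hn h0
    exact hn (by simp [h0])
  · filter_upwards [Lp.coeFn_smul (s n : ℂ) (amb (e n) (η n)), coeFn_amb (e n) (η n)] with z h1 h2
    refine h1.trans ?_
    rw [Pi.smul_apply, h2, smul_eq_mul]

/-- The bounded operator on `𝒮²` extending `𝔗_m`. -/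
def fwMulS2 (m : LInfPhase d) : S2 d →L[ℂ] S2 d :=
  (fourierWignerL2 d).symm.toContinuousLinearEquiv.toContinuousLinearMap ∘L mulOp m ∘L
    (fourierWignerL2 d).toContinuousLinearEquiv.toContinuousLinearMap

theorem norm_fwMulS2 (m : LInfPhase d) : ‖fwMulS2 m‖ = ‖m‖ :=
  (norm_conj_unitary _ _ _).trans (norm_mulOp m)

theorem extendsFWMul_fwMulS2 (m : LInfPhase d) : ExtendsFWMul m (fwMulS2 m) := by
  intro T hT f g
  have hae : (fun z => mulOp m (fourierWignerL2 d T) z * starRingEnd ℂ (ambFun g f z)) =ᵐ[volume]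
      fun z => m z * fourierWigner T.toOp z * ⟪g, rho z f⟫_ℂ := by
    filter_upwards [coeFn_mulOp m (fourierWignerL2 d T), fourierWignerL2_ae_eq hT] with z h1 h2
    rw [h1, h2, ambFun, inner_conj_symm]
  refine ⟨(integrable_mul_conj (Lp.memLp _) (memLp_ambFun g f)).congr hae, ?_⟩
  rw [← integral_congr_ae hae, ← inner_amb_eq_integral, ← inner_amb_fourierWignerL2]
  congr 1
  exact (fourierWignerL2 d).apply_symm_apply _

theorem isTraceClass_rankOne (u : L2 d) {v : L2 d} (hv : ‖v‖ = 1) :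
    IsTraceClass (InnerProductSpace.rankOne ℂ u v) := by
  -- For `u = 0` there is no unit vector to normalise to, so the empty decomposition is used.
  by_cases hu : u = 0
  · refine ⟨Empty, fun _ => 0, fun _ => 0, fun _ => 0, fun _ => le_rfl, summable_zero,
      ⟨fun i => i.elim, fun i => i.elim⟩, ⟨fun i => i.elim, fun i => i.elim⟩, ?_⟩
    simp [hu]
  · refine ⟨Unit, fun _ => ‖u‖, fun _ => (‖u‖⁻¹ : ℂ) • u, fun _ => v, fun _ => norm_nonneg _,
      Summable.of_finite, ?_, ?_, ?_⟩
    · refine ⟨fun _ => ?_, fun i j h => (h (Subsingleton.elim i j)).elim⟩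
      simp [norm_smul, hu]
    · exact ⟨fun _ => hv, fun i j h => (h (Subsingleton.elim i j)).elim⟩
    · have h : InnerProductSpace.rankOne ℂ u v =
          (‖u‖ : ℂ) • InnerProductSpace.rankOne ℂ ((‖u‖⁻¹ : ℂ) • u) v := by
        simp [smul_smul, hu]
      rw [h]
      exact hasSum_unique (β := Unit) _

theorem S2.toOp_coordsEquiv_symm_single [DecidableEq (onbIndex d)] (i : onbIndex d) (u : L2 d) :
    ((S2.coordsEquiv d).symm (lp.single 2 i u)).toOp = InnerProductSpace.rankOne ℂ u (onb d i) := by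
  refine ContinuousLinearMap.ext_on
    (Submodule.dense_iff_topologicalClosure_eq_top.mpr (onb d).dense_span) ?_
  rintro _ ⟨j, rfl⟩
  have h := congrArg (fun x : lp (fun _ : onbIndex d => L2 d) 2 => x j)
    ((S2.coordsEquiv d).apply_symm_apply (lp.single 2 i u))
  refine Eq.trans h ?_
  rw [InnerProductSpace.rankOne_apply]
  by_cases hij : j = i
  · subst hij
    simp [(onb d).orthonormal.1]
  · rw [(onb d).orthonormal.2 (Ne.symm hij), zero_smul, lp.single_apply_ne _ _ _ hij]

theorem ExtendsFWMul.unique {m : LInfPhase d} {A A' : S2 d →L[ℂ] S2 d}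
    (hA : ExtendsFWMul m A) (hA' : ExtendsFWMul m A') : A = A' := by
  classical
  have key (T : S2 d) (hT : IsTraceClass T.toOp) : A T = A' T :=
    S2.ext_inner fun f g => ((hA T hT f g).2).trans ((hA' T hT f g).2).symm
  refine ContinuousLinearMap.ext fun T => ?_
  -- In the `𝒮²` norm `T` is the sum of the rank-one operators `⟨eᵢ, ·⟩ T eᵢ`, which are trace
  -- class, so both extensions agree on each term.
  have h := (lp.hasSum_single (p := 2) (by norm_num) (S2.coordsEquiv d T)).mapL
    (S2.coordsEquiv d).symm.toContinuousLinearEquiv.toContinuousLinearMap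
  have hT : (S2.coordsEquiv d).symm.toContinuousLinearEquiv.toContinuousLinearMap
      (S2.coordsEquiv d T) = T := (S2.coordsEquiv d).symm_apply_apply T
  rw [hT] at h
  refine (h.mapL A).unique ((h.mapL A').congr_fun fun i => key _ ?_)
  change IsTraceClass ((S2.coordsEquiv d).symm (lp.single 2 i _)).toOp
  rw [S2.toOp_coordsEquiv_symm_single]
  exact isTraceClass_rankOne _ ((onb d).orthonormal.1 i)

theorem fwMultiplierNorm_eq (m : LInfPhase d) : fwMultiplierNorm m = ‖m‖ := by
  have : {r | ∃ A : S2 d →L[ℂ] S2 d, ExtendsFWMul m A ∧ r = ‖A‖} = {‖m‖} := by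
    ext r
    constructor
    · rintro ⟨A, hA, rfl⟩
      rw [hA.unique (extendsFWMul_fwMulS2 m), norm_fwMulS2]
      rfl
    · rintro rfl
      exact ⟨_, extendsFWMul_fwMulS2 m, (norm_fwMulS2 m).symm⟩
  rw [fwMultiplierNorm, this, csInf_singleton]

end HilbertSchmidt

end FourierWigner

end

theorem mainTheorem4 (d : ℕ) :
    FourierWigner.fwMultipliers d = Set.univ ∧
    FourierWigner.fourierMultipliers d = Set.univ ∧
    ∀ m : FourierWigner.LInfPhase d,
      (∃! A : FourierWigner.S2 d →L[ℂ] FourierWigner.S2 d, FourierWigner.ExtendsFWMul m A) ∧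
      (∃! B : FourierWigner.L2Phase d →L[ℂ] FourierWigner.L2Phase d,
        FourierWigner.ExtendsFourierMul m B) ∧
      FourierWigner.fwMultiplierNorm m = FourierWigner.fourierMultiplierNorm m ∧
      FourierWigner.fourierMultiplierNorm m = ‖m‖ := by
  refine ⟨Set.eq_univ_of_forall fun m => ⟨_, FourierWigner.extendsFWMul_fwMulS2 m⟩,
    Set.eq_univ_of_forall fun m => ⟨_, FourierWigner.extendsFourierMul_fourierMulL2 m⟩,
    fun m => ⟨⟨_, FourierWigner.extendsFWMul_fwMulS2 m,
      fun A hA => hA.unique (FourierWigner.extendsFWMul_fwMulS2 m)⟩,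
      ⟨_, FourierWigner.extendsFourierMul_fourierMulL2 m,
        fun B hB => hB.unique (FourierWigner.extendsFourierMul_fourierMulL2 m)⟩, ?_,
      FourierWigner.fourierMultiplierNorm_eq m⟩⟩
  rw [FourierWigner.fwMultiplierNorm_eq, FourierWigner.fourierMultiplierNorm_eq]
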